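/- For $n\in\mathbb N$ let $L(\mathbb C^n)$ be the lattice of all linear subspaces of $\mathbb C^n$, with meet $p\wedge q=p\cap q$, join $p\vee q=\operatorname{span}(p\cup q)$, complement $\bar p=p^{\perp}$ (the orthogonal complement for the standard Hermitian inner product), least element $\mathbf 0=\{0\}$ and greatest element $\mathbf 1=\mathbb C^n$. It is regarded as a structure for the first-order language of complemented lattices, whose symbols are $\wedge,\vee,\bar{\ },\mathbf 0,\mathbf 1$. The reals are regarded as a structure for the first-order language of rings, whose symbols are $+,\cdot,-,0,1$. There is an effective procedure (that is, one given by a total recursive function on Gödel numbers) which, given a natural number $n$ and a sentence $\varphi$ in the first-order language of complemented lattices, gives a sentence $\varphi^*$ in the first-order language of rings such that the following are equivalent: \begin{enumerate} \item $L(\mathbb C^n)\models\varphi$. \item $\mathbb R\models\varphi^*$. \end{enumerate} -/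

import Mathlib

/-! ## The first-order language of complemented lattices -/

/-- The operation symbols of complemented lattices: meet, join, complement and the bounds. -/
inductive CompLatticeFunc : ℕ → Type
  | inf : CompLatticeFunc 2
  | sup : CompLatticeFunc 2
  | compl : CompLatticeFunc 1
  | bot : CompLatticeFunc 0
  | top : CompLatticeFunc 0

/-- The first-order language of complemented lattices.  The order is not a primitive symbol:
`p ≤ q` is the formula `p ∧ q = p`. -/
def compLatticeLang : FirstOrder.Language.{0, 0} where
  Functions := CompLatticeFunc
  Relations := fun _ => Empty

/-! ## The two structures -/

/-- The lattice `L(ℂⁿ)` of all linear subspaces of the Hilbert space `ℂⁿ`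
(all of them are closed). -/
abbrev SubspaceLattice (n : ℕ) : Type :=
  Submodule ℂ (EuclideanSpace ℂ (Fin n))

/-- `L(ℂⁿ)` as a structure: meet is intersection, join is the span of the union, the complement
is the orthogonal complement for the standard Hermitian inner product. -/
noncomputable instance SubspaceLattice.structure (n : ℕ) :
    compLatticeLang.Structure (SubspaceLattice n) where
  funMap {_} f :=
    match f with
    | .inf => fun x => x 0 ⊓ x 1
    | .sup => fun x => x 0 ⊔ x 1
    | .compl => fun x => (x 0)ᗮ
    | .bot => fun _ => ⊥
    | .top => fun _ => ⊤
  RelMap {_} r := Empty.elim r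

/-- The real field as a structure for the language `+, *, -, 0, 1` of rings. -/
noncomputable instance Real.ringStructure : FirstOrder.Language.ring.Structure ℝ :=
  (FirstOrder.Ring.compatibleRingOfRing ℝ).toStructure

/-! ## Gödel numbers of sentences -/

/-- A numbering of the operation symbols of each arity. -/
instance CompLatticeFunc.encodable : ∀ i, Encodable (compLatticeLang.Functions i)
  | 0 => { encode := fun f : CompLatticeFunc 0 => match f with
             | .bot => 0
             | .top => 1
           decode := fun
             | 0 => some CompLatticeFunc.bot
             | 1 => some CompLatticeFunc.top
             | _ => none
           encodek := fun f : CompLatticeFunc 0 => by cases f <;> rfl }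
  | 1 => { encode := fun _ : CompLatticeFunc 1 => 0
           decode := fun
             | 0 => some CompLatticeFunc.compl
             | _ => none
           encodek := fun f : CompLatticeFunc 1 => by cases f; rfl }
  | 2 => { encode := fun f : CompLatticeFunc 2 => match f with
             | .inf => 0
             | .sup => 1
           decode := fun
             | 0 => some CompLatticeFunc.inf
             | 1 => some CompLatticeFunc.sup
             | _ => none
           encodek := fun f : CompLatticeFunc 2 => by cases f <;> rfl }
  | n + 3 => { encode := fun _ => 0
               decode := fun _ => none
               encodek := fun f : CompLatticeFunc (n + 3) => nomatch f }

instance compLatticeLang.encodableRelations (i : ℕ) : Encodable (compLatticeLang.Relations i) :=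
  inferInstanceAs (Encodable Empty)

/-- A numbering of the operation symbols of each arity. -/
instance ringLang.encodableFunctions : ∀ i, Encodable (FirstOrder.Language.ring.Functions i)
  | 0 => { encode := fun f : FirstOrder.ringFunc 0 => match f with
             | .zero => 0
             | .one => 1
           decode := fun
             | 0 => some FirstOrder.ringFunc.zero
             | 1 => some FirstOrder.ringFunc.one
             | _ => none
           encodek := fun f : FirstOrder.ringFunc 0 => by cases f <;> rfl }
  | 1 => { encode := fun _ : FirstOrder.ringFunc 1 => 0
           decode := fun
             | 0 => some FirstOrder.ringFunc.neg
             | _ => none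
           encodek := fun f : FirstOrder.ringFunc 1 => by cases f; rfl }
  | 2 => { encode := fun f : FirstOrder.ringFunc 2 => match f with
             | .add => 0
             | .mul => 1
           decode := fun
             | 0 => some FirstOrder.ringFunc.add
             | 1 => some FirstOrder.ringFunc.mul
             | _ => none
           encodek := fun f : FirstOrder.ringFunc 2 => by cases f <;> rfl }
  | n + 3 => { encode := fun _ => 0
               decode := fun _ => none
               encodek := fun f : FirstOrder.ringFunc (n + 3) => nomatch f }

instance ringLang.encodableRelations (i : ℕ) :
    Encodable (FirstOrder.Language.ring.Relations i) :=
  inferInstanceAs (Encodable Empty)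

section Godel

variable {L : FirstOrder.Language.{0, 0}} [∀ i, Encodable (L.Functions i)]
  [∀ i, Encodable (L.Relations i)]

/-- The Gödel number of a term in the variables `0, …, k - 1`: a variable is coded by its index,
a compound term by the arity and number of its head symbol and the list of the Gödel numbers
of the arguments. -/
def termGodel {k : ℕ} : L.Term (Empty ⊕ Fin k) → ℕ
  | .var (.inl e) => e.elim
  | .var (.inr i) => Nat.pair 0 i
  | .func (l := l) f ts =>
      Nat.pair 1 (Nat.pair (Nat.pair l (Encodable.encode f))
        (Encodable.encode (List.ofFn fun i => termGodel (ts i))))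

/-- The Gödel number of a formula whose free variables are among `0, …, k - 1`
(a quantifier in it binds the variable with index `k`); `falsum` and the atomic formulas also
record `k`. -/
def formulaGodel : {k : ℕ} → L.BoundedFormula Empty k → ℕ
  | k, .falsum => Nat.pair 0 k
  | k, .equal t₁ t₂ => Nat.pair 1 (Nat.pair k (Nat.pair (termGodel t₁) (termGodel t₂)))
  | k, .rel (l := l) R ts =>
      Nat.pair 2 (Nat.pair k (Nat.pair (Nat.pair l (Encodable.encode R))
        (Encodable.encode (List.ofFn fun i => termGodel (ts i)))))
  | _, .imp φ ψ => Nat.pair 3 (Nat.pair (formulaGodel φ) (formulaGodel ψ))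
  | _, .all φ => Nat.pair 4 (formulaGodel φ)

/-- The Gödel number of a sentence. -/
def sentenceGodel (φ : L.Sentence) : ℕ :=
  formulaGodel (k := 0) φ

end Godel

/-- An assignment of a sentence of `L'` to every natural number and sentence of `L` is an effective
procedure if it is computed, on Gödel numbers, by a total recursive function. -/
def IsEffectiveProcedure {L L' : FirstOrder.Language.{0, 0}}
    [∀ i, Encodable (L.Functions i)] [∀ i, Encodable (L.Relations i)]
    [∀ i, Encodable (L'.Functions i)] [∀ i, Encodable (L'.Relations i)]
    (F : ℕ → L.Sentence → L'.Sentence) : Prop :=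
  ∃ f : ℕ → ℕ → ℕ, Computable₂ f ∧
    ∀ (n : ℕ) (φ : L.Sentence), f n (sentenceGodel φ) = sentenceGodel (F n φ)

/-! Every subspace of ℂⁿ is the orthogonal complement of some n vectors, so it is given by 2n²
reals, and membership in it is a conjunction of polynomial equations. A quantifier over L(ℂⁿ) thus
becomes a block of 2n² real quantifiers. Different coordinates may give the same subspace, which is
harmless: every subspace occurs (`exists_coordSubspace_eq`), and the formulas speak only of the
subspaces. Equality means having the same vectors; join is reduced to meet by (p ∨ q)ᗮ = pᗮ ∧ qᗮ.

The translation is a function `trans` on Gödel numbers. Since `IsFormula` ties a number to the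
property it defines, correctness (`isFormula_trans`) and primitive recursiveness (`primrec_trans`)
are proved separately for the same function.

Terms are not translated recursively. An equation between the terms numbered s and t quantifies over
a table of subspaces indexed by all c ≤ s + t, each entry constrained by the entries at its
arguments. Arguments have smaller numbers, so such a table exists (`exists_eq_value`) and holds the
values of the terms (`realize_term`). -/

open FirstOrder FirstOrder.Language

/-! ### Gödel numbers of formulas in the language of rings -/

namespace RingGodel

/-- `c` is the Gödel number of a ring term in the variables `0, …, m - 1` with value `f`. -/
def IsTerm (m c : ℕ) (f : (ℕ → ℝ) → ℝ) : Prop :=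
  ∃ t : Language.ring.Term (Empty ⊕ Fin m), termGodel t = c ∧
    ∀ v : ℕ → ℝ, t.realize (Sum.elim (default : Empty → ℝ) fun i : Fin m => v i) = f v

/-- `c` is the Gödel number of a ring formula in the variables `0, …, m - 1` which defines `P`. -/
def IsFormula (m c : ℕ) (P : (ℕ → ℝ) → Prop) : Prop :=
  ∃ φ : Language.ring.BoundedFormula Empty m, formulaGodel φ = c ∧
    ∀ v : ℕ → ℝ, φ.Realize (default : Empty → ℝ) (fun i : Fin m => v i) ↔ P v

/-- The Gödel number of the variable `i`. -/
def var (i : ℕ) : ℕ := Nat.pair 0 i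

/-- The Gödel number of the constant `0`. -/
def zero : ℕ := Nat.pair 1 (Nat.pair (Nat.pair 0 0) 0)

/-- The Gödel number of `-s`. -/
def neg (s : ℕ) : ℕ := Nat.pair 1 (Nat.pair (Nat.pair 1 0) (Nat.pair s 0 + 1))

/-- The Gödel number of `s + t`. -/
def add (s t : ℕ) : ℕ :=
  Nat.pair 1 (Nat.pair (Nat.pair 2 0) (Nat.pair s (Nat.pair t 0 + 1) + 1))

/-- The Gödel number of `s * t`. -/
def mul (s t : ℕ) : ℕ :=
  Nat.pair 1 (Nat.pair (Nat.pair 2 1) (Nat.pair s (Nat.pair t 0 + 1) + 1))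

/-- The Gödel number of the sum of the terms `g j` for `j < n`. -/
def sum (n : ℕ) (g : ℕ → ℕ) : ℕ := n.rec zero fun j s => add s (g j)

/-- The Gödel number of `⊥`. -/
def bot (m : ℕ) : ℕ := Nat.pair 0 m

/-- The Gödel number of `s = t`. -/
def eq (m s t : ℕ) : ℕ := Nat.pair 1 (Nat.pair m (Nat.pair s t))

/-- The Gödel number of `a → b`. -/
def imp (a b : ℕ) : ℕ := Nat.pair 3 (Nat.pair a b)

/-- The Gödel number of `⊤`. -/
def top (m : ℕ) : ℕ := imp (bot m) (bot m)

/-- The Gödel number of a conjunction. -/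
def and (m a b : ℕ) : ℕ := imp (imp a (imp b (bot m))) (bot m)

/-- The Gödel number of an equivalence. -/
def iff (m a b : ℕ) : ℕ := and m (imp a b) (imp b a)

/-- The Gödel number of the conjunction of the formulas `g j` for `j < n`. -/
def conj (m n : ℕ) (g : ℕ → ℕ) : ℕ := n.rec (top m) fun j s => and m s (g j)

/-- The Gödel number of a formula with `d` universal quantifiers in front. -/
def alls (d a : ℕ) : ℕ := d.rec a fun _ s => Nat.pair 4 s

/-! ### Semantics of the coded connectives -/

section Realize

variable {m : ℕ}

theorem IsFormula.congr {c : ℕ} {P Q : (ℕ → ℝ) → Prop} (h : IsFormula m c P)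
    (hPQ : ∀ v, P v ↔ Q v) : IsFormula m c Q := by
  obtain ⟨φ, h1, h2⟩ := h
  exact ⟨φ, h1, fun v => (h2 v).trans (hPQ v)⟩

theorem IsTerm.var {i : ℕ} (hi : i < m) : IsTerm m (var i) fun v => v i :=
  ⟨.var (.inr ⟨i, hi⟩), by simp [termGodel, RingGodel.var], fun v => rfl⟩

theorem IsTerm.zero : IsTerm m zero fun _ => 0 :=
  ⟨.func (l := 0) ringFunc.zero ![], by simp [termGodel, RingGodel.zero]; rfl, fun v => rfl⟩

theorem IsTerm.neg {s : ℕ} {f : (ℕ → ℝ) → ℝ} (hs : IsTerm m s f) :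
    IsTerm m (neg s) fun v => -f v := by
  obtain ⟨t, h1, h2⟩ := hs
  refine ⟨.func (l := 1) ringFunc.neg ![t], ?_, fun v => ?_⟩
  · simp [termGodel, RingGodel.neg, List.ofFn_succ, h1]; rfl
  · exact congrArg (- ·) (h2 v)

theorem IsTerm.add {s t : ℕ} {f g : (ℕ → ℝ) → ℝ} (hs : IsTerm m s f) (ht : IsTerm m t g) :
    IsTerm m (add s t) fun v => f v + g v := by
  obtain ⟨t, h1, h2⟩ := hs
  obtain ⟨u, h3, h4⟩ := ht
  refine ⟨.func (l := 2) ringFunc.add ![t, u], ?_, fun v => ?_⟩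
  · simp [termGodel, RingGodel.add, List.ofFn_succ, h1, h3]; rfl
  · exact congrArg₂ (· + ·) (h2 v) (h4 v)

theorem IsTerm.mul {s t : ℕ} {f g : (ℕ → ℝ) → ℝ} (hs : IsTerm m s f) (ht : IsTerm m t g) :
    IsTerm m (mul s t) fun v => f v * g v := by
  obtain ⟨t, h1, h2⟩ := hs
  obtain ⟨u, h3, h4⟩ := ht
  refine ⟨.func (l := 2) ringFunc.mul ![t, u], ?_, fun v => ?_⟩
  · simp [termGodel, RingGodel.mul, List.ofFn_succ, h1, h3]; rfl
  · exact congrArg₂ (· * ·) (h2 v) (h4 v)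

theorem IsTerm.sum {n : ℕ} {g : ℕ → ℕ} {f : ℕ → (ℕ → ℝ) → ℝ}
    (h : ∀ j < n, IsTerm m (g j) (f j)) :
    IsTerm m (sum n g) fun v => ∑ j ∈ Finset.range n, f j v := by
  induction n with
  | zero => simpa using! IsTerm.zero
  | succ n ih =>
    simp only [Finset.sum_range_succ]
    exact (ih fun j hj => h j (by omega)).add (h n (by omega))

theorem IsFormula.bot : IsFormula m (bot m) fun _ => False :=
  ⟨.falsum, rfl, fun _ => _root_.Iff.rfl⟩

theorem IsFormula.eq {s t : ℕ} {f g : (ℕ → ℝ) → ℝ} (hs : IsTerm m s f) (ht : IsTerm m t g) :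
    IsFormula m (eq m s t) fun v => f v = g v := by
  obtain ⟨t, rfl, h2⟩ := hs
  obtain ⟨u, rfl, h4⟩ := ht
  exact ⟨.equal t u, rfl, fun v => iff_of_eq (congrArg₂ (· = ·) (h2 v) (h4 v))⟩

theorem IsFormula.imp {a b : ℕ} {P Q : (ℕ → ℝ) → Prop} (ha : IsFormula m a P)
    (hb : IsFormula m b Q) : IsFormula m (imp a b) fun v => P v → Q v := by
  obtain ⟨φ, rfl, h2⟩ := ha
  obtain ⟨ψ, rfl, h4⟩ := hb
  exact ⟨.imp φ ψ, rfl, fun v => imp_congr (h2 v) (h4 v)⟩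

theorem IsFormula.top : IsFormula m (top m) fun _ => True :=
  (IsFormula.bot.imp IsFormula.bot).congr fun _ => by simp

theorem IsFormula.and {a b : ℕ} {P Q : (ℕ → ℝ) → Prop} (ha : IsFormula m a P)
    (hb : IsFormula m b Q) : IsFormula m (and m a b) fun v => P v ∧ Q v :=
  ((ha.imp (hb.imp .bot)).imp .bot).congr fun _ => by tauto

theorem IsFormula.iff {a b : ℕ} {P Q : (ℕ → ℝ) → Prop} (ha : IsFormula m a P)
    (hb : IsFormula m b Q) : IsFormula m (iff m a b) fun v => (P v ↔ Q v) :=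
  ((ha.imp hb).and (hb.imp ha)).congr fun _ => by tauto

theorem IsFormula.conj {n : ℕ} {g : ℕ → ℕ} {P : ℕ → (ℕ → ℝ) → Prop}
    (h : ∀ j < n, IsFormula m (g j) (P j)) :
    IsFormula m (conj m n g) fun v => ∀ j < n, P j v := by
  induction n with
  | zero => exact IsFormula.top.congr fun _ => by simp
  | succ n ih =>
    exact ((ih fun j hj => h j (by omega)).and (h n (by omega))).congr fun v =>
      Nat.forall_lt_succ_right.symm

/-- Assignments are infinite sequences, so that positions can be computed freely. The body sees only
positions up to `m`, hence varying the whole tail from `m` on is the same as varying the entry at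
`m`. -/
theorem IsFormula.all {a : ℕ} {P : (ℕ → ℝ) → Prop} (h : IsFormula (m + 1) a P) :
    IsFormula m (Nat.pair 4 a) fun v => ∀ w : ℕ → ℝ, (∀ i < m, w i = v i) → P w := by
  obtain ⟨φ, rfl, h2⟩ := h
  refine ⟨.all φ, rfl, fun v => ⟨fun H w hw => ?_, fun H x => ?_⟩⟩
  · rw [← h2 w]
    convert! H (w m) using 1
    funext i
    refine Fin.lastCases ?_ (fun i => ?_) i
    · simp
    · simp [hw i i.2]
  · have := H (Function.update v m x) fun i hi => Function.update_of_ne hi.ne _ _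
    rw [← h2] at this
    convert! this using 1
    funext i
    refine Fin.lastCases ?_ (fun i => ?_) i
    · simp
    · simp [Function.update_of_ne i.2.ne]

theorem IsFormula.alls {d a : ℕ} {P : (ℕ → ℝ) → Prop} (h : IsFormula (m + d) a P) :
    IsFormula m (alls d a) fun v => ∀ w : ℕ → ℝ, (∀ i < m, w i = v i) → P w := by
  induction d generalizing m with
  | zero =>
    -- With no quantifier, `P` must itself ignore positions from `m` on; the formula behind `h`
    -- ensures this.
    refine h.congr fun v => ⟨fun hv w hw => ?_, fun H => H v fun _ _ => rfl⟩
    obtain ⟨φ, -, h2⟩ := h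
    rw [← h2] at hv ⊢
    convert! hv using 1
    funext i
    exact hw i i.2
  | succ d ih =>
    rw [show m + (d + 1) = m + 1 + d by omega] at h
    refine (ih h).all.congr fun v => ⟨fun H w hw => H w hw w fun _ _ => rfl, fun H w hw u hu =>
      H u fun i hi => (hu i (by omega)).trans (hw i hi)⟩

end Realize

/-! ### Primitive recursiveness of the coded connectives -/

section Primrec

variable {α : Type*} [Primcodable α] {n m a b : α → ℕ}

theorem primrec_pair (ha : Primrec a) (hb : Primrec b) :
    Primrec fun x => Nat.pair (a x) (b x) :=
  Primrec₂.natPair.comp ha hb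

theorem primrec_var (ha : Primrec a) : Primrec fun x => var (a x) :=
  primrec_pair (.const 0) ha

theorem primrec_neg (ha : Primrec a) : Primrec fun x => neg (a x) :=
  primrec_pair (.const _) (primrec_pair (.const _) (Primrec.succ.comp
    (primrec_pair ha (.const _))))

theorem primrec_add (ha : Primrec a) (hb : Primrec b) : Primrec fun x => add (a x) (b x) :=
  primrec_pair (.const _) (primrec_pair (.const _) (Primrec.succ.comp
    (primrec_pair ha (Primrec.succ.comp (primrec_pair hb (.const _))))))

theorem primrec_mul (ha : Primrec a) (hb : Primrec b) : Primrec fun x => mul (a x) (b x) :=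
  primrec_pair (.const _) (primrec_pair (.const _) (Primrec.succ.comp
    (primrec_pair ha (Primrec.succ.comp (primrec_pair hb (.const _))))))

theorem primrec_bot (hm : Primrec m) : Primrec fun x => bot (m x) :=
  primrec_pair (.const _) hm

theorem primrec_eq (hm : Primrec m) (ha : Primrec a) (hb : Primrec b) :
    Primrec fun x => eq (m x) (a x) (b x) :=
  primrec_pair (.const _) (primrec_pair hm (primrec_pair ha hb))

theorem primrec_imp (ha : Primrec a) (hb : Primrec b) : Primrec fun x => imp (a x) (b x) :=
  primrec_pair (.const _) (primrec_pair ha hb)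

theorem primrec_top (hm : Primrec m) : Primrec fun x => top (m x) :=
  primrec_imp (primrec_bot hm) (primrec_bot hm)

theorem primrec_and (hm : Primrec m) (ha : Primrec a) (hb : Primrec b) :
    Primrec fun x => and (m x) (a x) (b x) :=
  primrec_imp (primrec_imp ha (primrec_imp hb (primrec_bot hm))) (primrec_bot hm)

theorem primrec_iff (hm : Primrec m) (ha : Primrec a) (hb : Primrec b) :
    Primrec fun x => iff (m x) (a x) (b x) :=
  primrec_and hm (primrec_imp ha hb) (primrec_imp hb ha)

theorem primrec_sum {g : α → ℕ → ℕ} (hn : Primrec n) (hg : Primrec fun x : α × ℕ => g x.1 x.2) :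
    Primrec fun x => sum (n x) (g x) :=
  Primrec.nat_rec' hn (.const zero) (h := fun x p => add p.2 (g x p.1))
    (primrec_add (.comp .snd .snd) (hg.comp (.pair .fst (.comp .fst .snd))))

theorem primrec_conj {g : α → ℕ → ℕ} (hm : Primrec m) (hn : Primrec n)
    (hg : Primrec fun x : α × ℕ => g x.1 x.2) : Primrec fun x => conj (m x) (n x) (g x) :=
  Primrec.nat_rec' hn (primrec_top hm) (h := fun x p => and (m x) p.2 (g x p.1))
    (primrec_and (hm.comp .fst) (.comp .snd .snd) (hg.comp (.pair .fst (.comp .fst .snd))))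

theorem primrec_alls (hn : Primrec n) (ha : Primrec a) : Primrec fun x => alls (n x) (a x) :=
  Primrec.nat_rec' hn ha (h := fun _ p => Nat.pair 4 p.2)
    (primrec_pair (.const _) (.comp .snd .snd))

end Primrec

end RingGodel

/-! ### Coordinates of vectors and subspaces -/

/-- The vector of `ℂⁿ` whose real and imaginary parts are listed in `v`, from position `o` on. -/
noncomputable def coordVec (n : ℕ) (v : ℕ → ℝ) (o : ℕ) : EuclideanSpace ℂ (Fin n) :=
  WithLp.toLp 2 fun j => ⟨v (o + 2 * j), v (o + 2 * j + 1)⟩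

/-- The orthogonal complement of the `n` vectors listed in `v`, from position `o` on. -/
noncomputable def coordSubspace (n : ℕ) (v : ℕ → ℝ) (o : ℕ) : SubspaceLattice n :=
  (Submodule.span ℂ (Set.range fun i : Fin n => coordVec n v (o + 2 * n * i)))ᗮ

theorem inner_coordVec_eq_zero_iff (n : ℕ) (v : ℕ → ℝ) (o p : ℕ) :
    inner ℂ (coordVec n v o) (coordVec n v p) = 0 ↔
      ∑ j ∈ Finset.range n, (v (o + 2 * j) * v (p + 2 * j) +
        v (o + 2 * j + 1) * v (p + 2 * j + 1)) = 0 ∧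
      ∑ j ∈ Finset.range n, (v (o + 2 * j) * v (p + 2 * j + 1) +
        -(v (o + 2 * j + 1) * v (p + 2 * j))) = 0 := by
  rw [Complex.ext_iff, Finset.sum_range, Finset.sum_range]
  simp only [PiLp.inner_apply, coordVec, Complex.re_sum, Complex.im_sum, RCLike.inner_apply,
    Complex.mul_re, Complex.mul_im, Complex.conj_re, Complex.conj_im, Complex.zero_re,
    Complex.zero_im]
  refine and_congr (Eq.congr_left (Finset.sum_congr rfl fun j _ => ?_))
    (Eq.congr_left (Finset.sum_congr rfl fun j _ => ?_)) <;> ring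

/-- This quantifier-free test is the reason for coding a subspace by vectors orthogonal to it
instead of spanning vectors. -/
theorem mem_coordSubspace (n : ℕ) (v : ℕ → ℝ) (o : ℕ) (x : EuclideanSpace ℂ (Fin n)) :
    x ∈ coordSubspace n v o ↔ ∀ i < n, inner ℂ (coordVec n v (o + 2 * n * i)) x = 0 := by
  rw [coordSubspace, Submodule.mem_orthogonal]
  refine ⟨fun h i hi => h _ (Submodule.subset_span ⟨⟨i, hi⟩, rfl⟩), fun h u hu => ?_⟩
  induction hu using Submodule.span_induction with
  | mem u hu =>
    obtain ⟨i, rfl⟩ := hu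
    exact h i i.2
  | zero => simp
  | add u w _ _ hu hw => rw [inner_add_left, hu, hw, add_zero]
  | smul a u _ hu => rw [inner_smul_left, hu, mul_zero]

theorem coordVec_congr {n : ℕ} {v w : ℕ → ℝ} {o : ℕ}
    (h : ∀ i < o + 2 * n, w i = v i) : coordVec n w o = coordVec n v o := by
  ext j
  have := j.2
  simp only [coordVec]
  rw [h _ (by omega), h _ (by omega)]

theorem coordSubspace_congr {n : ℕ} {v w : ℕ → ℝ} {o : ℕ}
    (h : ∀ i < o + 2 * n * n, w i = v i) : coordSubspace n w o = coordSubspace n v o := by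
  simp only [coordSubspace]
  congr! 4 with i
  refine coordVec_congr fun l hl => h l ?_
  have := Nat.mul_le_mul_left (2 * n) (Nat.succ_le_of_lt i.2)
  rw [Nat.mul_succ] at this
  omega

theorem exists_coordVec_eq {n : ℕ} (v : ℕ → ℝ) (o : ℕ) (x : ℕ → EuclideanSpace ℂ (Fin n)) :
    ∃ w : ℕ → ℝ, (∀ i < o, w i = v i) ∧ ∀ c, coordVec n w (o + 2 * n * c) = x c := by
  -- `z` concatenates the coordinates of all `x c`; the default `0` is reached only for `n = 0`.
  let z (i : ℕ) : ℂ := if h : i % n < n then x (i / n) ⟨i % n, h⟩ else 0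
  have hz (c : ℕ) (j : Fin n) : z (n * c + j) = x c j := by
    have hn : 0 < n := j.pos
    have h1 : (n * c + j) % n = j := by simp [Nat.mod_eq_of_lt j.2]
    have h2 : (n * c + j) / n = c := by
      rw [Nat.mul_add_div hn, Nat.div_eq_of_lt j.2, add_zero]
    simp only [z, h1, h2, j.2, dif_pos]
  refine ⟨fun i => if i < o then v i else
    if (i - o) % 2 = 0 then (z ((i - o) / 2)).re else (z ((i - o) / 2)).im,
    fun i hi => if_pos hi, fun c => ?_⟩
  ext j
  have h1 : o + 2 * n * c + 2 * j - o = 2 * (n * c + j) := by rw [mul_assoc]; omega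
  have h2 : o + 2 * n * c + 2 * j + 1 - o = 2 * (n * c + j) + 1 := by rw [mul_assoc]; omega
  have h3 : (2 * (n * c + j) + 1) / 2 = n * c + j := by omega
  have h4 : (2 * (n * c + j) + 1) % 2 = 1 := by omega
  have h5 : ¬ o + 2 * n * c + 2 * j < o := by omega
  have h6 : ¬ o + 2 * n * c + 2 * j + 1 < o := by omega
  simp [coordVec, h1, h2, h3, h4, h5, h6, hz]

/-- The projections of the standard basis vectors span the range of the projection, so n vectors
suffice in every dimension. -/
theorem exists_span_range_eq {n : ℕ} (K : SubspaceLattice n) :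
    ∃ x : Fin n → EuclideanSpace ℂ (Fin n), Submodule.span ℂ (Set.range x) = K := by
  refine ⟨fun i => K.starProjection (EuclideanSpace.basisFun (Fin n) ℂ i), ?_⟩
  have h := Submodule.map_span K.starProjection.toLinearMap
    (Set.range (EuclideanSpace.basisFun (Fin n) ℂ))
  rw [← OrthonormalBasis.coe_toBasis, Module.Basis.span_eq, Submodule.map_top] at h
  rw [← Set.range_comp] at h
  have h2 := K.range_starProjection
  simp only [OrthonormalBasis.coe_toBasis] at h
  exact h.symm.trans h2

theorem exists_coordSubspace_eq {n : ℕ} (v : ℕ → ℝ) (o : ℕ) (X : ℕ → SubspaceLattice n) :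
    ∃ w : ℕ → ℝ, (∀ i < o, w i = v i) ∧ ∀ c, coordSubspace n w (o + 2 * n * n * c) = X c := by
  -- The listed vectors must span the complement of the wanted subspace.
  choose x hx using fun c => exists_span_range_eq (X c)ᗮ
  obtain ⟨w, hw, h⟩ := exists_coordVec_eq (n := n) v o fun i =>
    if h : i % n < n then x (i / n) ⟨i % n, h⟩ else 0
  refine ⟨w, hw, fun c => ?_⟩
  rw [← (X c).orthogonal_orthogonal, ← hx, coordSubspace]
  congr! 4 with i
  have hn : 0 < n := i.pos
  have h1 : (n * c + i) % n = i := by simp [Nat.mod_eq_of_lt i.2]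
  have h2 : (n * c + i) / n = c := by
    rw [Nat.mul_add_div hn, Nat.div_eq_of_lt i.2, add_zero]
  rw [show o + 2 * n * n * c + 2 * n * i = o + 2 * n * (n * c + i) by ring, h]
  simp only [h1, h2, i.2, dif_pos]

/-! ### Translation of the lattice operations -/

namespace LatticeTranslation

open RingGodel

variable {n k m : ℕ}

/-- The Gödel number of: the vectors at `o` and `p` are orthogonal. -/
def isOrth (n m o p : ℕ) : ℕ :=
  RingGodel.and m
    (eq m (sum n fun j => add (mul (var (o + 2 * j)) (var (p + 2 * j)))
      (mul (var (o + 2 * j + 1)) (var (p + 2 * j + 1)))) zero)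
    (eq m (sum n fun j => add (mul (var (o + 2 * j)) (var (p + 2 * j + 1)))
      (neg (mul (var (o + 2 * j + 1)) (var (p + 2 * j))))) zero)

/-- The Gödel number of: the vector at `o` belongs to the subspace at `p`. -/
def isMem (n m o p : ℕ) : ℕ := conj m n fun i => isOrth n m (p + 2 * n * i) o

/-- The Gödel number of: the vector at `o` is orthogonal to the subspace at `p`. -/
def isPerp (n m o p : ℕ) : ℕ :=
  alls (2 * n) (imp (isMem n (m + 2 * n) m p) (isOrth n (m + 2 * n) m o))

theorem isFormula_isOrth {o p : ℕ} (ho : o + 2 * n ≤ m) (hp : p + 2 * n ≤ m) :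
    IsFormula m (isOrth n m o p) fun v => inner ℂ (coordVec n v o) (coordVec n v p) = 0 := by
  simp only [inner_coordVec_eq_zero_iff]
  refine .and (.eq (.sum fun j hj => ?_) .zero) (.eq (.sum fun j hj => ?_) .zero)
  · exact .add (.mul (.var (by omega)) (.var (by omega))) (.mul (.var (by omega)) (.var (by omega)))
  · exact .add (.mul (.var (by omega)) (.var (by omega)))
      (.neg (.mul (.var (by omega)) (.var (by omega))))

theorem isFormula_isMem {o p : ℕ} (ho : o + 2 * n ≤ m) (hp : p + 2 * n * n ≤ m) :
    IsFormula m (isMem n m o p) fun v => coordVec n v o ∈ coordSubspace n v p := by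
  simp only [mem_coordSubspace]
  refine .conj fun i hi => isFormula_isOrth ?_ ho
  have := Nat.mul_le_mul_left (2 * n) (Nat.succ_le_of_lt hi)
  rw [Nat.mul_succ] at this
  omega

/-- The `2 * n` fresh variables hold the coordinates of `x`; `hQ` says that `Q` otherwise depends
only on positions below `m`. -/
theorem _root_.RingGodel.IsFormula.forall_vec {a : ℕ}
    {Q : (ℕ → ℝ) → EuclideanSpace ℂ (Fin n) → Prop}
    (h : IsFormula (m + 2 * n) a fun w => Q w (coordVec n w m))
    (hQ : ∀ v w : ℕ → ℝ, (∀ i < m, w i = v i) → ∀ x, Q w x ↔ Q v x) :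
    IsFormula m (alls (2 * n) a) fun v => ∀ x, Q v x := by
  refine h.alls.congr fun v => ⟨fun H x => ?_, fun H w hw => (hQ v w hw _).2 (H _)⟩
  obtain ⟨w, hw, h2⟩ := exists_coordVec_eq v m fun _ => x
  have h3 := H w hw
  rw [hQ v w hw] at h3
  rwa [← h2 0]

theorem isFormula_isPerp {o p : ℕ} (ho : o + 2 * n ≤ m) (hp : p + 2 * n * n ≤ m) :
    IsFormula m (isPerp n m o p) fun v => coordVec n v o ∈ (coordSubspace n v p)ᗮ := by
  simp only [Submodule.mem_orthogonal]
  refine .forall_vec (Q := fun v x => x ∈ coordSubspace n v p → inner ℂ x (coordVec n v o) = 0)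
    ((isFormula_isMem le_rfl (by omega)).imp (isFormula_isOrth le_rfl (by omega)))
    fun v w hw x => ?_
  rw [coordSubspace_congr fun i hi => hw i (by omega),
    coordVec_congr fun i hi => hw i (by omega)]

/-- The part of the Gödel number of a compound term which codes its head symbol. -/
def head (c : ℕ) : ℕ := c.unpair.2.unpair.1

/-- The Gödel number of the first argument of a compound term. -/
def fstArg (c : ℕ) : ℕ := (c.unpair.2.unpair.2 - 1).unpair.1

/-- The Gödel number of the second argument of a compound term. -/
def sndArg (c : ℕ) : ℕ := ((c.unpair.2.unpair.2 - 1).unpair.2 - 1).unpair.1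

/-- A pair is at least the sum of its components. This makes the recursion on arguments well founded
for all numbers, not only for those of terms. -/
theorem unpair_snd_lt {c : ℕ} (hc : c.unpair.1 ≠ 0) : c.unpair.2 < c := by
  have := Nat.add_le_pair c.unpair.1 c.unpair.2
  rw [Nat.pair_unpair] at this
  omega

theorem fstArg_lt {c : ℕ} (hc : c.unpair.1 ≠ 0) : fstArg c < c :=
  (Nat.unpair_left_le _).trans_lt <| (Nat.sub_le _ _).trans_lt <|
    (Nat.unpair_right_le _).trans_lt (unpair_snd_lt hc)

theorem sndArg_lt {c : ℕ} (hc : c.unpair.1 ≠ 0) : sndArg c < c :=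
  (Nat.unpair_left_le _).trans_lt <| (Nat.sub_le _ _).trans_lt <|
    (Nat.unpair_right_le _).trans_lt <| (Nat.sub_le _ _).trans_lt <|
    (Nat.unpair_right_le _).trans_lt (unpair_snd_lt hc)

/-- The value of the term with Gödel number `c` if the variables have the values `Y` and the
terms with smaller Gödel numbers have the values `X`. -/
noncomputable def value (k : ℕ) (Y X : ℕ → SubspaceLattice n) (c : ℕ) : SubspaceLattice n :=
  if c.unpair.1 = 0 then if c.unpair.2 < k then Y c.unpair.2 else ⊤
  else if head c = Nat.pair 2 0 then X (fstArg c) ⊓ X (sndArg c)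
  else if head c = Nat.pair 2 1 then X (fstArg c) ⊔ X (sndArg c)
  else if head c = Nat.pair 1 0 then (X (fstArg c))ᗮ
  else if head c = Nat.pair 0 0 then ⊥
  else ⊤

/-- The Gödel number of a formula which describes, by means of the vector at `u`, that the
subspace at `p + 2 * n * n * c` is the value of the term with Gödel number `c`. -/
def isValueAt (n k m u p c : ℕ) : ℕ :=
  if c.unpair.1 = 0 then
    if c.unpair.2 < k then
      iff m (isMem n m u (p + 2 * n * n * c)) (isMem n m u (2 * n * n * c.unpair.2))
    else iff m (isMem n m u (p + 2 * n * n * c)) (top m)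
  else if head c = Nat.pair 2 0 then
    iff m (isMem n m u (p + 2 * n * n * c))
      (RingGodel.and m (isMem n m u (p + 2 * n * n * fstArg c))
        (isMem n m u (p + 2 * n * n * sndArg c)))
  else if head c = Nat.pair 2 1 then
    iff m (isPerp n m u (p + 2 * n * n * c))
      (RingGodel.and m (isPerp n m u (p + 2 * n * n * fstArg c))
        (isPerp n m u (p + 2 * n * n * sndArg c)))
  else if head c = Nat.pair 1 0 then
    iff m (isMem n m u (p + 2 * n * n * c)) (isPerp n m u (p + 2 * n * n * fstArg c))
  else if head c = Nat.pair 0 0 then iff m (isPerp n m u (p + 2 * n * n * c)) (top m)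
  else iff m (isMem n m u (p + 2 * n * n * c)) (top m)

theorem mul_add_le_mul {d a b : ℕ} (h : a < b) : d * a + d ≤ d * b := by
  rw [← Nat.mul_succ]
  exact Nat.mul_le_mul_left d h

theorem orthogonal_inj {K K' : SubspaceLattice n} : Kᗮ = K'ᗮ ↔ K = K' :=
  ⟨fun h => by rw [← K.orthogonal_orthogonal, h, K'.orthogonal_orthogonal], fun h => h ▸ rfl⟩

theorem isFormula_isValue {c N : ℕ} (hc : c < N) (hm : 2 * n * n * k + 2 * n * n * N = m) :
    IsFormula m (alls (2 * n) (isValueAt n k (m + 2 * n) m (2 * n * n * k) c)) fun v =>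
      coordSubspace n v (2 * n * n * k + 2 * n * n * c) =
        value k (fun i => coordSubspace n v (2 * n * n * i))
          (fun c => coordSubspace n v (2 * n * n * k + 2 * n * n * c)) c := by
  have hX {a : ℕ} (ha : a ≤ c) : 2 * n * n * k + 2 * n * n * a + 2 * n * n ≤ m := by
    have := mul_add_le_mul (d := 2 * n * n) (ha.trans_lt hc)
    omega
  have hY {r : ℕ} (hr : r < k) : 2 * n * n * r + 2 * n * n ≤ m := by
    have := mul_add_le_mul (d := 2 * n * n) hr
    omega
  have hmem {a : ℕ} (ha : a ≤ c) := isFormula_isMem (n := n) (m := m + 2 * n) (o := m)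
    (p := 2 * n * n * k + 2 * n * n * a) le_rfl ((hX ha).trans (by omega))
  have hperp {a : ℕ} (ha : a ≤ c) := isFormula_isPerp (n := n) (m := m + 2 * n) (o := m)
    (p := 2 * n * n * k + 2 * n * n * a) le_rfl ((hX ha).trans (by omega))
  have hsub {a : ℕ} (ha : a ≤ c) {v w : ℕ → ℝ} (hw : ∀ i < m, w i = v i) :=
    coordSubspace_congr (n := n) fun i hi => hw i (hi.trans_le (hX ha))
  unfold isValueAt value
  split_ifs with h0 h1 h2 h3 h4 h5
  · have hr : IsFormula (m + 2 * n) _ _ := isFormula_isMem (n := n) (o := m)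
      (p := 2 * n * n * c.unpair.2) le_rfl ((hY h1).trans (by omega))
    refine (IsFormula.forall_vec (Q := fun v x => (x ∈ coordSubspace n v _ ↔
      x ∈ coordSubspace n v _)) ((hmem le_rfl).iff hr) fun v w hw x => ?_).congr fun v => ?_
    · rw [hsub le_rfl hw, coordSubspace_congr fun i hi => hw i (hi.trans_le (hY h1))]
    · exact SetLike.ext_iff.symm
  · refine (IsFormula.forall_vec (Q := fun v x => (x ∈ coordSubspace n v _ ↔ True))
      ((hmem le_rfl).iff .top) fun v w hw x => ?_).congr fun v => ?_
    · rw [hsub le_rfl hw]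
    · simp [SetLike.ext_iff]
  · have ha := (fstArg_lt h0).le
    have hb := (sndArg_lt h0).le
    refine (IsFormula.forall_vec (Q := fun v x => (x ∈ coordSubspace n v _ ↔
      x ∈ coordSubspace n v _ ∧ x ∈ coordSubspace n v _))
      ((hmem le_rfl).iff ((hmem ha).and (hmem hb))) fun v w hw x => ?_).congr fun v => ?_
    · rw [hsub le_rfl hw, hsub ha hw, hsub hb hw]
    · simp [SetLike.ext_iff]
  · have ha := (fstArg_lt h0).le
    have hb := (sndArg_lt h0).le
    refine (IsFormula.forall_vec (Q := fun v x => (x ∈ (coordSubspace n v _)ᗮ ↔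
      x ∈ (coordSubspace n v _)ᗮ ∧ x ∈ (coordSubspace n v _)ᗮ))
      ((hperp le_rfl).iff ((hperp ha).and (hperp hb))) fun v w hw x => ?_).congr fun v => ?_
    · rw [hsub le_rfl hw, hsub ha hw, hsub hb hw]
    -- For the join, orthogonal complements are compared, turning a sum of subspaces into an
    -- intersection.
    · rw [← orthogonal_inj, ← Submodule.inf_orthogonal, SetLike.ext_iff]
      simp only [Submodule.mem_inf]
  · have ha := (fstArg_lt h0).le
    refine (IsFormula.forall_vec (Q := fun v x => (x ∈ coordSubspace n v _ ↔
      x ∈ (coordSubspace n v _)ᗮ))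
      ((hmem le_rfl).iff (hperp ha)) fun v w hw x => ?_).congr fun v => ?_
    · rw [hsub le_rfl hw, hsub ha hw]
    · exact SetLike.ext_iff.symm
  · refine (IsFormula.forall_vec (Q := fun v x => (x ∈ (coordSubspace n v _)ᗮ ↔ True))
      ((hperp le_rfl).iff .top) fun v w hw x => ?_).congr fun v => ?_
    · rw [hsub le_rfl hw]
    · rw [← orthogonal_inj, Submodule.bot_orthogonal_eq_top, SetLike.ext_iff]
      simp only [Submodule.mem_top]
  · refine (IsFormula.forall_vec (Q := fun v x => (x ∈ coordSubspace n v _ ↔ True))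
      ((hmem le_rfl).iff .top) fun v w hw x => ?_).congr fun v => ?_
    · rw [hsub le_rfl hw]
    · simp [SetLike.ext_iff]

theorem value_congr {Y X X' : ℕ → SubspaceLattice n} {c : ℕ} (h : ∀ a < c, X a = X' a) :
    value k Y X c = value k Y X' c := by
  unfold value
  split_ifs with h0
  all_goals try rfl
  all_goals simp only [h _ (fstArg_lt h0), h _ (sndArg_lt h0)]

theorem exists_eq_value (k : ℕ) (Y : ℕ → SubspaceLattice n) :
    ∃ X : ℕ → SubspaceLattice n, ∀ c, X c = value k Y X c := by
  let F (c : ℕ) (ih : ∀ a, a < c → SubspaceLattice n) : SubspaceLattice n :=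
    -- Entries at `a ≥ c` are never read, so the default is immaterial.
    value k Y (fun a => if h : a < c then ih a h else ⊥) c
  refine ⟨WellFounded.fix Nat.lt_wfRel.wf F, fun c => ?_⟩
  rw [WellFounded.fix_eq]
  exact value_congr fun a ha => dif_pos ha

/-- Any table obeying the recursion below `N` is forced, by induction on the term, to contain its
value. -/
theorem realize_term {N : ℕ} {Y : Fin k → SubspaceLattice n} {Z X : ℕ → SubspaceLattice n}
    (hZ : ∀ i : Fin k, Z i = Y i) (hX : ∀ c < N, X c = value k Z X c)
    (t : compLatticeLang.Term (Empty ⊕ Fin k)) (ht : termGodel t < N) :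
    t.realize (Sum.elim (default : Empty → SubspaceLattice n) Y) = X (termGodel t) := by
  induction t with
  | var x =>
    obtain e | i := x
    · exact e.elim
    · rw [hX _ ht]
      simp [termGodel, value, hZ]
  | @func l f ts ih =>
    have hlt (i : Fin l) : termGodel (ts i) < termGodel (Term.func f ts) := by
      have h1 : termGodel (ts i) < Encodable.encode (List.ofFn fun i => termGodel (ts i)) := by
        -- The code of a nonempty list is the successor of a pair; this successor is also what the
        -- `- 1` in `fstArg` and `sndArg` undoes.
        have (l : List ℕ) (a : ℕ) (ha : a ∈ l) : a < Encodable.encode l := by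
          induction l with
          | nil => simp at ha
          | cons b l ihl =>
            rw [Encodable.encode_list_cons, Nat.lt_succ_iff]
            rcases List.mem_cons.1 ha with rfl | ha
            · exact Nat.left_le_pair _ _
            · exact (ihl ha).le.trans (Nat.right_le_pair _ _)
        exact this _ _ (List.mem_ofFn.2 ⟨i, rfl⟩)
      exact h1.trans_le ((Nat.right_le_pair _ _).trans (Nat.right_le_pair _ _))
    have ih' (i : Fin l) := ih i ((hlt i).trans ht)
    rw [hX _ ht]
    cases f with
    | inf =>
      refine (congrArg₂ (· ⊓ ·) (ih' 0) (ih' 1)).trans ?_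
      have : Encodable.encode (α := compLatticeLang.Functions 2) CompLatticeFunc.inf = 0 := rfl
      simp [value, termGodel, head, fstArg, sndArg, this, List.ofFn_succ]
    | sup =>
      refine (congrArg₂ (· ⊔ ·) (ih' 0) (ih' 1)).trans ?_
      have : Encodable.encode (α := compLatticeLang.Functions 2) CompLatticeFunc.sup = 1 := rfl
      simp [value, termGodel, head, fstArg, sndArg, this, List.ofFn_succ]
    | compl =>
      refine (congrArg Submodule.orthogonal (ih' 0)).trans ?_
      have : Encodable.encode (α := compLatticeLang.Functions 1) CompLatticeFunc.compl = 0 := rfl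
      simp [value, termGodel, head, fstArg, this, List.ofFn_succ]
    | bot =>
      have : Encodable.encode (α := compLatticeLang.Functions 0) CompLatticeFunc.bot = 0 := rfl
      simp [value, termGodel, head, this]
      rfl
    | top =>
      have : Encodable.encode (α := compLatticeLang.Functions 0) CompLatticeFunc.top = 1 := rfl
      simp [value, termGodel, head, this]
      rfl

end LatticeTranslation

/-! ### Translation of formulas -/

namespace LatticeTranslation

open RingGodel

variable {n k m : ℕ}

/-- The Gödel number of the translation of the equation, in `k` variables, between the terms with
Gödel numbers `s` and `t`: the values of all terms with Gödel numbers at most `s + t` are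
quantified over. -/
def eqTrans (n k s t : ℕ) : ℕ :=
  let m := 2 * n * n * k + 2 * n * n * (s + t + 1)
  alls (2 * n * n * (s + t + 1)) <| imp
    (conj m (s + t + 1) fun c =>
      alls (2 * n) (isValueAt n k (m + 2 * n) m (2 * n * n * k) c))
    (alls (2 * n) (iff (m + 2 * n) (isMem n (m + 2 * n) m (2 * n * n * k + 2 * n * n * s))
      (isMem n (m + 2 * n) m (2 * n * n * k + 2 * n * n * t))))

/-- The bound `s + t + 1` serves only to exceed both `s` and `t`; the indices below it are closed
under passing to arguments. -/
theorem isFormula_eqTrans (s t : ℕ) :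
    IsFormula (2 * n * n * k) (eqTrans n k s t) fun v => ∀ X : ℕ → SubspaceLattice n,
      (∀ c < s + t + 1, X c = value k (fun i => coordSubspace n v (2 * n * n * i)) X c) →
        X s = X t := by
  have hX {a : ℕ} (ha : a < s + t + 1) : 2 * n * n * k + 2 * n * n * a + 2 * n * n ≤
      2 * n * n * k + 2 * n * n * (s + t + 1) := by
    have := mul_add_le_mul (d := 2 * n * n) ha
    omega
  have hmem {a : ℕ} (ha : a < s + t + 1) := isFormula_isMem (n := n)
    (m := 2 * n * n * k + 2 * n * n * (s + t + 1) + 2 * n)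
    (o := 2 * n * n * k + 2 * n * n * (s + t + 1))
    (p := 2 * n * n * k + 2 * n * n * a) le_rfl ((hX ha).trans (by omega))
  have hsub {a : ℕ} (ha : a < s + t + 1) {v w : ℕ → ℝ}
      (hw : ∀ i < 2 * n * n * k + 2 * n * n * (s + t + 1), w i = v i) :=
    coordSubspace_congr (n := n) fun i hi => hw i (hi.trans_le (hX ha))
  have hs : s < s + t + 1 := by omega
  have ht : t < s + t + 1 := by omega
  have heq : IsFormula (2 * n * n * k + 2 * n * n * (s + t + 1)) _ fun v =>
      coordSubspace n v (2 * n * n * k + 2 * n * n * s) =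
        coordSubspace n v (2 * n * n * k + 2 * n * n * t) :=
    (IsFormula.forall_vec (Q := fun v x => (x ∈ coordSubspace n v _ ↔ x ∈ coordSubspace n v _))
      ((hmem hs).iff (hmem ht)) fun v w hw x => by rw [hsub hs hw, hsub ht hw]).congr
      fun v => SetLike.ext_iff.symm
  refine ((IsFormula.conj fun c hc => isFormula_isValue hc rfl).imp heq).alls.congr
    fun v => ⟨fun H X hX => ?_, fun H w hw hc => ?_⟩
  · obtain ⟨w, hw, h⟩ := exists_coordSubspace_eq v (2 * n * n * k) X
    have := H w hw
    simp only [h] at this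
    refine this fun c hc => (hX c hc).trans ?_
    unfold value
    split_ifs with h0 h1
    -- Variables are read only at indices below `k`, where `v` and `w` give the same subspaces.
    · refine (coordSubspace_congr fun i hi => hw i (hi.trans_le ?_)).symm
      exact mul_add_le_mul h1
    all_goals rfl
  · refine H (fun c => coordSubspace n w (2 * n * n * k + 2 * n * n * c)) fun c hcN =>
      (hc c hcN).trans ?_
    unfold value
    split_ifs with h0 h1
    · refine coordSubspace_congr fun i hi => hw i (hi.trans_le ?_)
      exact mul_add_le_mul h1
    all_goals rfl

/-- The Gödel number of the translation of the formula whose Gödel number is the length of `l`,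
where `l` lists the Gödel numbers of the translations of formulas with smaller numbers. -/
def transStep (n : ℕ) (l : List ℕ) : ℕ :=
  if l.length.unpair.1 = 0 then bot (2 * n * n * l.length.unpair.2)
  else if l.length.unpair.1 = 1 then
    eqTrans n l.length.unpair.2.unpair.1 l.length.unpair.2.unpair.2.unpair.1
      l.length.unpair.2.unpair.2.unpair.2
  else if l.length.unpair.1 = 3 then
    imp (l.getD l.length.unpair.2.unpair.1 0) (l.getD l.length.unpair.2.unpair.2 0)
  else alls (2 * n * n) (l.getD l.length.unpair.2 0)

/-- The Gödel numbers of the translations of the formulas with Gödel number less than `g`. -/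
def transList (n g : ℕ) : List ℕ := g.rec [] fun _ l => l ++ [transStep n l]

/-- The Gödel number of the translation of the formula with Gödel number `g` about `L(ℂⁿ)`. -/
def trans (n g : ℕ) : ℕ := transStep n (transList n g)

/-- This puts `trans` in the form of a course-of-values recursion, in which the current number is
the length of the list of earlier values. -/
theorem transList_eq (n g : ℕ) : transList n g = (List.range g).map (trans n) := by
  induction g with
  | zero => rfl
  | succ g ih =>
    rw [List.range_succ, List.map_append, ← ih]
    rfl

theorem getD_transList {g a : ℕ} (ha : a < g) : (transList n g).getD a 0 = trans n a := by
  simp [transList_eq, List.getD_eq_getElem?_getD, ha]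

theorem length_transList (n g : ℕ) : (transList n g).length = g := by
  simp [transList_eq]

theorem trans_imp (a b : ℕ) :
    trans n (Nat.pair 3 (Nat.pair a b)) = imp (trans n a) (trans n b) := by
  have h := Nat.add_le_pair 3 (Nat.pair a b)
  have ha := Nat.left_le_pair a b
  have hb := Nat.right_le_pair a b
  rw [trans, transStep, length_transList]
  simp only [Nat.unpair_pair]
  rw [getD_transList (by omega), getD_transList (by omega)]
  simp

theorem trans_all (a : ℕ) : trans n (Nat.pair 4 a) = alls (2 * n * n) (trans n a) := by
  have h := Nat.add_le_pair 4 a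
  rw [trans, transStep, length_transList]
  simp only [Nat.unpair_pair]
  rw [getD_transList (a := a) (by omega)]
  simp

/-- Lattice variable `i` occupies the real block starting at `2 * n * n * i`, so binding index `k`
means binding the next block. As `falsum` and equations record `k` in their numbers, `trans` finds
the offsets from the number alone. -/
theorem isFormula_trans (φ : compLatticeLang.BoundedFormula Empty k) :
    IsFormula (2 * n * n * k) (trans n (formulaGodel φ)) fun v =>
      φ.Realize (default : Empty → SubspaceLattice n)
        fun i : Fin k => coordSubspace n v (2 * n * n * i) := by
  induction φ with
  | @falsum k =>
    have : trans n (formulaGodel (BoundedFormula.falsum (L := compLatticeLang) (α := Empty)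
        (n := k))) = bot (2 * n * n * k) := by
      rw [trans, transStep, length_transList]
      simp [formulaGodel]
    rw [this]
    exact .bot
  | @equal k s t =>
    have : trans n (formulaGodel (BoundedFormula.equal s t)) =
        eqTrans n k (termGodel s) (termGodel t) := by
      rw [trans, transStep, length_transList]
      simp [formulaGodel]
    rw [this]
    refine (isFormula_eqTrans _ _).congr fun v => ?_
    have key {X : ℕ → SubspaceLattice n} (hX : ∀ c < termGodel s + termGodel t + 1,
        X c = value k (fun i => coordSubspace n v (2 * n * n * i)) X c) :
        (BoundedFormula.equal s t).Realize (default : Empty → SubspaceLattice n)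
          (fun i : Fin k => coordSubspace n v (2 * n * n * i)) ↔
            X (termGodel s) = X (termGodel t) := by
      rw [← realize_term (fun _ => rfl) hX s (by omega),
        ← realize_term (fun _ => rfl) hX t (by omega)]
      rfl
    refine ⟨fun H => ?_, fun H X hX => (key hX).1 H⟩
    -- The translation is universal over tables, so it has content only because some table exists.
    obtain ⟨X, hX⟩ := exists_eq_value k fun i => coordSubspace n v (2 * n * n * i)
    exact (key fun c _ => hX c).2 (H X fun c _ => hX c)
  | rel R => exact Empty.elim R
  | imp φ ψ ih1 ih2 =>
    rw [formulaGodel, trans_imp]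
    exact ih1.imp ih2
  | @all k φ ih =>
    rw [formulaGodel, trans_all]
    rw [Nat.mul_succ] at ih
    refine ih.alls.congr fun v => ⟨fun H K => ?_, fun H w hw => ?_⟩
    · obtain ⟨w, hw, h⟩ := exists_coordSubspace_eq v (2 * n * n * k) fun _ => K
      convert! H w hw using 1
      funext i
      refine Fin.lastCases ?_ (fun i => ?_) i
      · simpa using (h 0).symm
      · simp only [Fin.snoc_castSucc, Fin.val_castSucc]
        exact (coordSubspace_congr fun j hj => hw j (hj.trans_le (mul_add_le_mul i.2))).symm
    · convert! H (coordSubspace n w (2 * n * n * k)) using 1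
      funext i
      refine Fin.lastCases ?_ (fun i => ?_) i
      · simp
      · simp only [Fin.snoc_castSucc, Fin.val_castSucc]
        exact coordSubspace_congr fun j hj => hw j (hj.trans_le (mul_add_le_mul i.2))

/-! ### Primitive recursiveness of the translation, uniformly in `n` -/

section Primrec

variable {α : Type*} [Primcodable α] {n k m u o p c s t : α → ℕ}

local notation "add'" => Primrec.nat_add.comp
local notation "mul'" => Primrec.nat_mul.comp

theorem primrec_isOrth (hn : Primrec n) (hm : Primrec m) (ho : Primrec o) (hp : Primrec p) :
    Primrec fun x => isOrth (n x) (m x) (o x) (p x) := by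
  have ev {q : α → ℕ} (hq : Primrec q) : Primrec fun y : α × ℕ => RingGodel.var (q y.1 + 2 * y.2) :=
    primrec_var (add' (hq.comp .fst) (mul' (.const 2) .snd))
  have od {q : α → ℕ} (hq : Primrec q) : Primrec fun y : α × ℕ => RingGodel.var (q y.1 + 2 * y.2 + 1) :=
    primrec_var (Primrec.succ.comp (add' (hq.comp .fst) (mul' (.const 2) .snd)))
  exact primrec_and hm
    (primrec_eq hm (primrec_sum hn (primrec_add (primrec_mul (ev ho) (ev hp))
      (primrec_mul (od ho) (od hp)))) (.const _))
    (primrec_eq hm (primrec_sum hn (primrec_add (primrec_mul (ev ho) (od hp))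
      (primrec_neg (primrec_mul (od ho) (ev hp))))) (.const _))

theorem primrec_isMem (hn : Primrec n) (hm : Primrec m) (ho : Primrec o) (hp : Primrec p) :
    Primrec fun x => isMem (n x) (m x) (o x) (p x) :=
  primrec_conj hm hn (primrec_isOrth (hn.comp .fst) (hm.comp .fst)
    (add' (hp.comp .fst) (mul' (mul' (.const 2) (hn.comp .fst)) .snd)) (ho.comp .fst))

theorem primrec_isPerp (hn : Primrec n) (hm : Primrec m) (ho : Primrec o) (hp : Primrec p) :
    Primrec fun x => isPerp (n x) (m x) (o x) (p x) := by
  have h2n : Primrec fun x => 2 * n x := mul' (.const 2) hn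
  exact primrec_alls h2n (primrec_imp (primrec_isMem hn (add' hm h2n) hm hp)
    (primrec_isOrth hn (add' hm h2n) hm ho))

theorem primrec_unpair_fst (hc : Primrec c) : Primrec fun x => (c x).unpair.1 :=
  Primrec.fst.comp (Primrec.unpair.comp hc)

theorem primrec_unpair_snd (hc : Primrec c) : Primrec fun x => (c x).unpair.2 :=
  Primrec.snd.comp (Primrec.unpair.comp hc)

theorem primrec_isValueAt (hn : Primrec n) (hk : Primrec k) (hm : Primrec m) (hu : Primrec u)
    (hp : Primrec p) (hc : Primrec c) :
    Primrec fun x => isValueAt (n x) (k x) (m x) (u x) (p x) (c x) := by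
  have hd : Primrec fun x => 2 * n x * n x := mul' (mul' (.const 2) hn) hn
  have h1 := primrec_unpair_fst hc
  have h2 := primrec_unpair_snd hc
  have hh : Primrec fun x => head (c x) := primrec_unpair_fst h2
  have hl : Primrec fun x => (c x).unpair.2.unpair.2 - 1 :=
    Primrec.pred.comp (primrec_unpair_snd h2)
  have ha : Primrec fun x => fstArg (c x) := primrec_unpair_fst hl
  have hb : Primrec fun x => sndArg (c x) :=
    primrec_unpair_fst (Primrec.pred.comp (primrec_unpair_snd hl))
  have mem {q : α → ℕ} (hq : Primrec q) :
      Primrec fun x => isMem (n x) (m x) (u x) (p x + 2 * n x * n x * q x) :=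
    primrec_isMem hn hm hu (add' hp (mul' hd hq))
  have perp {q : α → ℕ} (hq : Primrec q) :
      Primrec fun x => isPerp (n x) (m x) (u x) (p x + 2 * n x * n x * q x) :=
    primrec_isPerp hn hm hu (add' hp (mul' hd hq))
  have eq {q : α → ℕ} (hq : Primrec q) (b : ℕ) : PrimrecPred fun x => q x = b :=
    Primrec.eq.comp hq (.const b)
  exact .ite (eq h1 _)
    (.ite (Primrec.nat_lt.comp h2 hk)
      (primrec_iff hm (mem hc) (primrec_isMem hn hm hu (mul' hd h2)))
      (primrec_iff hm (mem hc) (primrec_top hm)))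
    (.ite (eq hh _) (primrec_iff hm (mem hc) (primrec_and hm (mem ha) (mem hb)))
      (.ite (eq hh _) (primrec_iff hm (perp hc) (primrec_and hm (perp ha) (perp hb)))
        (.ite (eq hh _) (primrec_iff hm (mem hc) (perp ha))
          (.ite (eq hh _) (primrec_iff hm (perp hc) (primrec_top hm))
            (primrec_iff hm (mem hc) (primrec_top hm))))))

theorem primrec_eqTrans (hn : Primrec n) (hk : Primrec k) (hs : Primrec s) (ht : Primrec t) :
    Primrec fun x => eqTrans (n x) (k x) (s x) (t x) := by
  have h2n : Primrec fun x => 2 * n x := mul' (.const 2) hn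
  have hd : Primrec fun x => 2 * n x * n x := mul' h2n hn
  have hN : Primrec fun x => s x + t x + 1 := Primrec.succ.comp (add' hs ht)
  have hp : Primrec fun x => 2 * n x * n x * k x := mul' hd hk
  have hm : Primrec fun x => 2 * n x * n x * k x + 2 * n x * n x * (s x + t x + 1) :=
    add' hp (mul' hd hN)
  have hm' := add' hm h2n
  exact primrec_alls (mul' hd hN) (primrec_imp
    (primrec_conj hm hN (primrec_alls (h2n.comp .fst) (primrec_isValueAt (hn.comp .fst)
      (hk.comp .fst) (hm'.comp .fst) (hm.comp .fst) (hp.comp .fst) .snd)))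
    (primrec_alls h2n (primrec_iff hm' (primrec_isMem hn hm' hm (add' hp (mul' hd hs)))
      (primrec_isMem hn hm' hm (add' hp (mul' hd ht))))))

theorem primrec_transStep : Primrec₂ transStep := by
  have hn : Primrec fun x : ℕ × List ℕ => x.1 := .fst
  have hd : Primrec fun x : ℕ × List ℕ => 2 * x.1 * x.1 := mul' (mul' (.const 2) hn) hn
  have hg : Primrec fun x : ℕ × List ℕ => x.2.length := Primrec.list_length.comp .snd
  have h1 := primrec_unpair_fst hg
  have h2 := primrec_unpair_snd hg
  have get {q : ℕ × List ℕ → ℕ} (hq : Primrec q) :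
      Primrec fun x : ℕ × List ℕ => x.2.getD (q x) 0 := (Primrec.list_getD 0).comp .snd hq
  have eq (b : ℕ) : PrimrecPred fun x : ℕ × List ℕ => x.2.length.unpair.1 = b :=
    Primrec.eq.comp h1 (.const b)
  exact .ite (eq _) (primrec_bot (mul' hd h2))
    (.ite (eq _) (primrec_eqTrans hn (primrec_unpair_fst h2)
        (primrec_unpair_fst (primrec_unpair_snd h2)) (primrec_unpair_snd (primrec_unpair_snd h2)))
      (.ite (eq _) (primrec_imp (get (primrec_unpair_fst h2)) (get (primrec_unpair_snd h2)))
        (primrec_alls hd (get h2))))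

theorem primrec_trans : Primrec₂ trans :=
  Primrec.nat_strong_rec trans (g := fun n l => some (transStep n l))
    (Primrec.option_some.comp primrec_transStep)
    fun n g => by rw [← transList_eq]; rfl

end Primrec

end LatticeTranslation

open LatticeTranslation in
theorem exists_sentenceGodel_eq_trans (n : ℕ) (φ : compLatticeLang.Sentence) :
    ∃ ψ : Language.ring.Sentence, sentenceGodel ψ = trans n (sentenceGodel φ) ∧
      (FirstOrder.Language.Sentence.Realize (SubspaceLattice n) φ ↔
        FirstOrder.Language.Sentence.Realize ℝ ψ) := by
  obtain ⟨ψ, h1, h2⟩ := isFormula_trans (n := n) (k := 0) φ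
  refine ⟨ψ, h1, ?_⟩
  exact (iff_of_eq (congrArg₂ (BoundedFormula.Realize (l := 0) φ)
      (Subsingleton.elim (α := Empty → SubspaceLattice n) _ _)
      (Subsingleton.elim (α := Fin 0 → SubspaceLattice n) _ _))).trans <|
    (h2 0).symm.trans (iff_of_eq (congrArg₂ (BoundedFormula.Realize (l := 0) ψ)
      (Subsingleton.elim (α := Empty → ℝ) _ _) (Subsingleton.elim (α := Fin 0 → ℝ) _ _)))

theorem theorem2 :
    ∃ F : ℕ → compLatticeLang.Sentence → FirstOrder.Language.ring.Sentence,
      IsEffectiveProcedure F ∧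
        ∀ (n : ℕ) (φ : compLatticeLang.Sentence),
          FirstOrder.Language.Sentence.Realize (SubspaceLattice n) φ ↔
            FirstOrder.Language.Sentence.Realize ℝ (F n φ) := by
  -- `F` is obtained by choice, but the Gödel numbers of its values are those computed by `trans`.
  choose F hF hR using exists_sentenceGodel_eq_trans
  exact ⟨F, ⟨LatticeTranslation.trans, LatticeTranslation.primrec_trans.to_comp,
    fun n φ => (hF n φ).symm⟩, hR⟩
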